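/- Let $K$ be a field and let $C$ be a $K$-coalgebra with comultiplication $\Delta(c)=\sum c_1\otimes c_2$. Let $C^*=\mathrm{Hom}_K(C,K)$ be the dual algebra, with product $(f*g)(c)=\sum f(c_1)g(c_2)$ and unit the counit of $C$. For a left $C$-comodule $M$ with coaction $m\mapsto\sum m_{-1}\otimes m_0\in C\otimes M$, the dual $M^*=\mathrm{Hom}_K(M,K)$ is a left $C^*$-module via $(f\cdot\varphi)(m)=\sum f(m_{-1})\varphi(m_0)$, and a comodule morphism $h:M\to N$ induces the $C^*$-linear map $h^*:N^*\to M^*$, $\varphi\mapsto\varphi\circ h$. A left $C$-comodule is Artinian if its subcomodules satisfy the descending chain condition, and finitely cogenerated if it embeds as a comodule in $C^n$ for some positive integer $n$. The coalgebra $C$ is left Artinian if it is Artinian as a left comodule over itself. Then $C$ is left Artinian if and only if $C^*$ is a left Noetherian ring. If this is the case, then: (1) a left $C$-comodule is Artinian if and only if it is finitely cogenerated; (2) a left $C^*$-module is Noetherian if and only if it is finitely generated; (3) the contravariant functor $M\mapsto M^*$, $h\mapsto h^*$, restricts to a duality (contravariant equivalence) from the full subcategory of Artinian (equivalently, finitely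 cogenerated) left $C$-comodules to the full subcategory of Noetherian (equivalently, finitely generated) left $C^*$-modules. -/

import Mathlib

open CategoryTheory TensorProduct

universe u v w

/-- The dual algebra `C^*` of a coalgebra `C`: linear forms on `C` with the convolution product
`(f * g)(c) = ∑ f(c₁) g(c₂)` and unit the counit (Mathlib's ring structure on `WithConv`). -/
abbrev DualAlg (K : Type u) (C : Type v) [Field K] [AddCommGroup C] [Module K C] :
    Type (max u v) :=
  WithConv (C →ₗ[K] K)

/-- A left comodule over the coalgebra `C`: a coassociative and counital coaction
`M → C ⊗ M`, `m ↦ ∑ m₋₁ ⊗ m₀`. -/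
class LeftComodule (K : Type u) (C : Type v) (M : Type w) [Field K] [AddCommGroup C] [Module K C]
    [Coalgebra K C] [AddCommGroup M] [Module K M] where
  coact : M →ₗ[K] C ⊗[K] M
  coassoc : (TensorProduct.assoc K C C M).toLinearMap ∘ₗ
      (Coalgebra.comul (R := K) (A := C)).rTensor M ∘ₗ coact = coact.lTensor C ∘ₗ coact
  counit_coact : (Coalgebra.counit (R := K) (A := C)).rTensor M ∘ₗ coact = TensorProduct.mk K K M 1

namespace LeftComodule

section Basic

variable (K : Type u) (C : Type v) [Field K] [AddCommGroup C] [Module K C] [Coalgebra K C]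
variable (M : Type w) [AddCommGroup M] [Module K M]

/-- The coalgebra `C` as a left comodule over itself. -/
instance self : LeftComodule K C C where
  coact := Coalgebra.comul
  coassoc := Coalgebra.coassoc
  counit_coact := Coalgebra.rTensor_counit_comp_comul

/-- The finite (co)power `M^n` of a left comodule, with the componentwise coaction. -/
instance pi {ι : Type} [Fintype ι] [DecidableEq ι] [LeftComodule K C M] :
    LeftComodule K C (ι → M) where
  coact := ∑ i, (LinearMap.single K (fun _ : ι => M) i).lTensor C ∘ₗ coact ∘ₗ LinearMap.proj i
  coassoc := by
    refine LinearMap.pi_ext' fun i => LinearMap.ext fun m => ?_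
    have h := LinearMap.congr_fun (coassoc (K := K) (C := C) (M := M)) m
    have hc : ∀ x : M, (∑ j, (LinearMap.single K (fun _ : ι => M) j).lTensor C ∘ₗ
        coact ∘ₗ LinearMap.proj j) (Pi.single i x) =
        (LinearMap.single K (fun _ : ι => M) i).lTensor C (coact x) := by
      intro x
      rw [LinearMap.sum_apply, Finset.sum_eq_single i]
      · simp
      · intro j _ hj
        simp [Pi.single_eq_of_ne hj]
      · simp
    have hL : ∀ t : C ⊗[K] M, TensorProduct.assoc K C C (ι → M)
        ((Coalgebra.comul (R := K) (A := C)).rTensor (ι → M)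
          ((LinearMap.single K (fun _ : ι => M) i).lTensor C t)) =
        ((LinearMap.single K (fun _ : ι => M) i).lTensor C).lTensor C
          (TensorProduct.assoc K C C M
            ((Coalgebra.comul (R := K) (A := C)).rTensor M t)) := by
      intro t
      induction t with
      | zero => simp
      | add x y hx hy => simp only [map_add, hx, hy]
      | tmul c x =>
        simp only [LinearMap.lTensor_tmul, LinearMap.rTensor_tmul]
        induction (Coalgebra.comul (R := K) c) with
        | zero => simp
        | add x y hx hy => simp only [map_add, add_tmul, hx, hy]
        | tmul a b => simp
    have hR : ∀ t : C ⊗[K] M, (∑ j, (LinearMap.single K (fun _ : ι => M) j).lTensor C ∘ₗ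
        coact ∘ₗ LinearMap.proj j).lTensor C
          ((LinearMap.single K (fun _ : ι => M) i).lTensor C t) =
        ((LinearMap.single K (fun _ : ι => M) i).lTensor C).lTensor C (coact.lTensor C t) := by
      intro t
      induction t with
      | zero => simp
      | add x y hx hy => simp only [map_add, hx, hy]
      | tmul c x =>
        simp only [LinearMap.lTensor_tmul, LinearMap.coe_single, hc]
    simp only [LinearMap.comp_apply, LinearMap.coe_single, LinearEquiv.coe_coe] at h ⊢
    rw [hc, hL, hR, h]
  counit_coact := by
    refine LinearMap.pi_ext' fun i => LinearMap.ext fun m => ?_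
    have h := LinearMap.congr_fun (counit_coact (K := K) (C := C) (M := M)) m
    have hc : (∑ j, (LinearMap.single K (fun _ : ι => M) j).lTensor C ∘ₗ
        coact ∘ₗ LinearMap.proj j) (Pi.single i m) =
        (LinearMap.single K (fun _ : ι => M) i).lTensor C (coact m) := by
      rw [LinearMap.sum_apply, Finset.sum_eq_single i]
      · simp
      · intro j _ hj
        simp [Pi.single_eq_of_ne hj]
      · simp
    have hL : ∀ t : C ⊗[K] M, (Coalgebra.counit (R := K) (A := C)).rTensor (ι → M)
          ((LinearMap.single K (fun _ : ι => M) i).lTensor C t) =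
        (LinearMap.single K (fun _ : ι => M) i).lTensor K
          ((Coalgebra.counit (R := K) (A := C)).rTensor M t) := by
      intro t
      induction t with
      | zero => simp
      | add x y hx hy => simp only [map_add, hx, hy]
      | tmul c x => simp
    simp only [LinearMap.comp_apply, LinearMap.coe_single] at h ⊢
    rw [hc, hL, h]
    simp

end Basic

section Dual

variable {K : Type u} {C : Type v} [Field K] [AddCommGroup C] [Module K C] [Coalgebra K C]
variable {M : Type w} [AddCommGroup M] [Module K M] [LeftComodule K C M]

/-- The action of `C^*` on `M^*`: `(f • φ)(m) = ∑ f(m₋₁) φ(m₀)`. -/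
noncomputable instance dualSMul : SMul (DualAlg K C) (Module.Dual K M) where
  smul f φ := LinearMap.mul' K K ∘ₗ TensorProduct.map f.ofConv φ ∘ₗ coact

theorem dual_smul_apply (f : DualAlg K C) (φ : Module.Dual K M) (m : M) :
    (f • φ) m = LinearMap.mul' K K (TensorProduct.map f.ofConv φ (coact m)) := rfl

/-- The dual `M^*` of a left `C`-comodule is a left `C^*`-module. -/
noncomputable instance dualModule : Module (DualAlg K C) (Module.Dual K M) where
  one_smul φ := by
    ext m
    have h := LinearMap.congr_fun (counit_coact (K := K) (C := C) (M := M)) m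
    have hL : ∀ t : C ⊗[K] M, LinearMap.mul' K K
        (TensorProduct.map (1 : DualAlg K C).ofConv φ t) =
        LinearMap.mul' K K (φ.lTensor K ((Coalgebra.counit (R := K) (A := C)).rTensor M t)) := by
      intro t
      induction t with
      | zero => simp
      | add x y hx hy => simp only [map_add, hx, hy]
      | tmul c x => simp [LinearMap.convOne_def]
    simp only [LinearMap.comp_apply] at h
    rw [dual_smul_apply, hL, h]
    simp
  mul_smul f g φ := by
    ext m
    have h := LinearMap.congr_fun (coassoc (K := K) (C := C) (M := M)) m
    have hL : ∀ t : C ⊗[K] M, LinearMap.mul' K K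
        (TensorProduct.map (f * g).ofConv φ t) =
        LinearMap.mul' K K (TensorProduct.map f.ofConv
          (LinearMap.mul' K K ∘ₗ TensorProduct.map g.ofConv φ)
          (TensorProduct.assoc K C C M
            ((Coalgebra.comul (R := K) (A := C)).rTensor M t))) := by
      intro t
      induction t with
      | zero => simp
      | add x y hx hy => simp only [map_add, hx, hy]
      | tmul c x =>
        simp only [LinearMap.rTensor_tmul, LinearMap.convMul_def, TensorProduct.map_tmul,
          LinearMap.comp_apply, LinearMap.mul'_apply]
        induction (Coalgebra.comul (R := K) c) with
        | zero => simp
        | add x y hx hy => simp only [map_add, add_tmul, add_mul, hx, hy]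
        | tmul a b => simp [mul_assoc]
    have hR : ∀ t : C ⊗[K] M, LinearMap.mul' K K (TensorProduct.map f.ofConv (g • φ) t) =
        LinearMap.mul' K K (TensorProduct.map f.ofConv
          (LinearMap.mul' K K ∘ₗ TensorProduct.map g.ofConv φ) (coact.lTensor C t)) := by
      intro t
      induction t with
      | zero => simp
      | add x y hx hy => simp only [map_add, hx, hy]
      | tmul c x => simp [dual_smul_apply]
    simp only [LinearMap.comp_apply, LinearEquiv.coe_coe] at h
    rw [dual_smul_apply, dual_smul_apply, hL, hR, h]
  smul_zero f := by
    ext m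
    simp [dual_smul_apply, TensorProduct.map_zero_right]
  smul_add f φ ψ := by
    ext m
    simp [dual_smul_apply, TensorProduct.map_add_right]
  add_smul f g φ := by
    ext m
    simp [dual_smul_apply, TensorProduct.map_add_left]
  zero_smul φ := by
    ext m
    simp [dual_smul_apply, TensorProduct.map_zero_left]

end Dual

section Properties

variable (K : Type u) (C : Type v) [Field K] [AddCommGroup C] [Module K C] [Coalgebra K C]
variable (M : Type w) [AddCommGroup M] [Module K M] [LeftComodule K C M]

/-- A subspace `N ⊆ M` is a subcomodule if the coaction maps it into `C ⊗ N ⊆ C ⊗ M`. -/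
def IsSubcomodule (N : Submodule K M) : Prop :=
  ∀ m ∈ N, coact (K := K) (C := C) m ∈ LinearMap.range (N.subtype.lTensor C)

/-- A left comodule is Artinian if its subcomodules satisfy the descending chain condition. -/
def IsArtinianComodule : Prop :=
  WellFoundedLT {N : Submodule K M // IsSubcomodule K C M N}

variable {K M} in
/-- A linear map of left comodules is a comodule morphism if it commutes with the coactions. -/
def IsComoduleHom {N : Type*} [AddCommGroup N] [Module K N] [LeftComodule K C N]
    (f : M →ₗ[K] N) : Prop :=
  f.lTensor C ∘ₗ coact = coact ∘ₗ f

/-- A left comodule is finitely cogenerated if it embeds, as a comodule, in `C^n` for some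
positive integer `n`. -/
def IsFinitelyCogenerated : Prop :=
  ∃ n : ℕ, 0 < n ∧ ∃ f : M →ₗ[K] (Fin n → C), IsComoduleHom C f ∧ Function.Injective f

end Properties

end LeftComodule

/-- A coalgebra is left Artinian if it is Artinian as a left comodule over itself. -/
def IsLeftArtinianCoalgebra (K : Type u) (C : Type v) [Field K] [AddCommGroup C] [Module K C]
    [Coalgebra K C] : Prop :=
  LeftComodule.IsArtinianComodule K C C

/-- Objects of the category of left `C`-comodules. -/
structure LeftComod (K : Type u) (C : Type v) [Field K] [AddCommGroup C] [Module K C]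
    [Coalgebra K C] where
  carrier : Type v
  [addCommGroup : AddCommGroup carrier]
  [module : Module K carrier]
  [comodule : LeftComodule K C carrier]

namespace LeftComod

attribute [instance] addCommGroup module comodule

section

variable {K : Type u} {C : Type v} [Field K] [AddCommGroup C] [Module K C] [Coalgebra K C]

/-- Morphisms of left comodules. -/
@[ext]
structure Hom (X Y : LeftComod K C) where
  toLin : X.carrier →ₗ[K] Y.carrier
  isHom : LeftComodule.IsComoduleHom C toLin

/-- The category of left `C`-comodules. -/
instance : Category (LeftComod K C) where
  Hom X Y := Hom X Y
  id X := ⟨LinearMap.id, by simp [LeftComodule.IsComoduleHom]⟩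
  comp {X Y Z} f g := ⟨g.toLin ∘ₗ f.toLin, by
    have hf := f.isHom
    have hg := g.isHom
    unfold LeftComodule.IsComoduleHom at hf hg ⊢
    rw [LinearMap.lTensor_comp, LinearMap.comp_assoc, hf, ← LinearMap.comp_assoc, hg,
      LinearMap.comp_assoc]⟩

end

variable (K : Type u) (C : Type v) [Field K] [AddCommGroup C] [Module K C] [Coalgebra K C]

/-- The contravariant functor `M ↦ M^*`, `h ↦ h^* = (φ ↦ φ ∘ h)`, from left `C`-comodules to left
`C^*`-modules. -/
noncomputable def dualFunctor : (LeftComod K C)ᵒᵖ ⥤ ModuleCat.{max u v} (DualAlg K C) where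
  obj X := ModuleCat.of (DualAlg K C) (Module.Dual K X.unop.carrier)
  map {X Y} h := ModuleCat.ofHom
    { toFun := fun φ => φ ∘ₗ h.unop.toLin
      map_add' := fun φ ψ => LinearMap.add_comp _ _ _
      map_smul' := fun f φ => by
        ext m
        have hh := LinearMap.congr_fun h.unop.isHom m
        simp only [LinearMap.comp_apply] at hh
        have hL : ∀ t : C ⊗[K] Y.unop.carrier,
            TensorProduct.map f.ofConv φ (h.unop.toLin.lTensor C t) =
            TensorProduct.map f.ofConv (φ ∘ₗ h.unop.toLin) t := by
          intro t
          rw [LinearMap.lTensor, ← LinearMap.comp_apply, ← TensorProduct.map_comp,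
            LinearMap.comp_id]
        simp only [LinearMap.comp_apply, LeftComodule.dual_smul_apply, RingHom.id_apply]
        rw [← hh, hL] }

/-- The Artinian left comodules. -/
def artinian : ObjectProperty (LeftComod K C) :=
  fun X => LeftComodule.IsArtinianComodule K C X.carrier

/-- The finitely cogenerated left comodules. -/
def finitelyCogenerated : ObjectProperty (LeftComod K C) :=
  fun X => LeftComodule.IsFinitelyCogenerated K C X.carrier

/-- The Noetherian left `C^*`-modules. -/
def noetherian : ObjectProperty (ModuleCat.{max u v} (DualAlg K C)) :=
  fun N => IsNoetherian (DualAlg K C) N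

/-- The finitely generated left `C^*`-modules. -/
def finitelyGenerated : ObjectProperty (ModuleCat.{max u v} (DualAlg K C)) :=
  fun N => Module.Finite (DualAlg K C) N

/-- `M ↦ M^*` is a duality between the full subcategories of the left `C`-comodules satisfying `P`
and the left `C^*`-modules satisfying `Q`: it maps the former to the latter, and the resulting
contravariant functor is an equivalence of categories. -/
def IsDuality (P : ObjectProperty (LeftComod K C))
    (Q : ObjectProperty (ModuleCat.{max u v} (DualAlg K C))) : Prop :=
  ∃ h : ∀ X : P.FullSubcategoryᵒᵖ, Q ((P.ι.op ⋙ dualFunctor K C).obj X),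
    (Q.lift (P.ι.op ⋙ dualFunctor K C) h).IsEquivalence

end LeftComod

/-!
Everything is read off on transposes. Since the functionals `f ⊗ φ` separate the points of
`C ⊗ M`, a linear map is a comodule morphism if and only if its transpose is `C^*`-linear, and
`N ⊆ M` is a subcomodule if and only if `N^⊥ ⊆ M^*` is a `C^*`-submodule. The module `(C^n)^*` is
free of rank `n`, and each `C^*`-linear map from it to `M^*` is the transpose of a comodule
morphism `M → C^n`. Hence a finitely generated submodule of `M^*` is the image of a transpose, that
is, the annihilator of a kernel, so that the descending chain condition on `M` becomes the ascending
one on `M^*`; and a finitely presented module `(C^n)^* / N^⊥` is the dual of `N`.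
-/

section Separation

variable {R M N : Type*} [CommSemiring R] [AddCommMonoid M] [Module R M] [Module.Free R M]
  [AddCommMonoid N] [Module R N] [Module.Free R N]

theorem tensorProduct_ext_dual {s t : M ⊗[R] N}
    (h : ∀ (f : Module.Dual R M) (g : Module.Dual R N),
      LinearMap.mul' R R (map f g s) = LinearMap.mul' R R (map f g t)) : s = t := by
  let b := Module.Free.chooseBasis R M
  let c := Module.Free.chooseBasis R N
  have repr_eq (x : M ⊗[R] N) (i j) :
      (b.tensorProduct c).repr x (i, j) =
        LinearMap.mul' R R (map (b.coord i) (c.coord j) x) := by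
    induction x with
    | zero => simp
    | add x y hx hy => simp only [map_add, Finsupp.add_apply, hx, hy]
    | tmul m n => simp [mul_comm]
  refine (b.tensorProduct c).repr.injective (Finsupp.ext fun ⟨i, j⟩ => ?_)
  rw [repr_eq, repr_eq, h]

end Separation

namespace LeftComodule

section Transpose

variable {K C M N : Type*} [Field K] [AddCommGroup C] [Module K C] [Coalgebra K C]
  [AddCommGroup M] [Module K M] [LeftComodule K C M]
  [AddCommGroup N] [Module K N] [LeftComodule K C N]

theorem smul_dualMap_apply (f : DualAlg K C) {V : Type*} [AddCommGroup V] [Module K V]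
    (h : M →ₗ[K] V) (φ : Module.Dual K V) (m : M) :
    (f • h.dualMap φ) m = LinearMap.mul' K K (map f.ofConv φ (h.lTensor C (coact m))) := by
  rw [dual_smul_apply, LinearMap.dualMap_apply', ← LinearMap.map_comp_lTensor,
    LinearMap.comp_apply]

theorem isComoduleHom_iff_dualMap_smul {h : M →ₗ[K] N} :
    IsComoduleHom C h ↔
      ∀ (f : DualAlg K C) (φ : Module.Dual K N), h.dualMap (f • φ) = f • h.dualMap φ := by
  constructor
  · intro hh f φ
    ext m
    have hm : coact (h m) = h.lTensor C (coact m) := (LinearMap.congr_fun hh m).symm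
    rw [smul_dualMap_apply, ← hm]
    rfl
  · intro hh
    refine LinearMap.ext fun m => tensorProduct_ext_dual fun f φ => ?_
    rw [LinearMap.comp_apply, ← smul_dualMap_apply (WithConv.toConv f), ← hh]
    rfl

/-- The transpose `h^* : N^* → M^*` of a comodule morphism `h : M → N`, as a `C^*`-linear map. -/
def IsComoduleHom.dualMap {h : M →ₗ[K] N} (hh : IsComoduleHom C h) :
    Module.Dual K N →ₗ[DualAlg K C] Module.Dual K M where
  toFun := h.dualMap
  map_add' := map_add _
  map_smul' := isComoduleHom_iff_dualMap_smul.1 hh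

theorem IsComoduleHom.dualMap_surjective_iff {h : M →ₗ[K] N} (hh : IsComoduleHom C h) :
    Function.Surjective hh.dualMap ↔ Function.Injective h :=
  LinearMap.dualMap_surjective_iff

theorem IsComoduleHom.of_comp_of_injective {P : Type*} [AddCommGroup P] [Module K P]
    [LeftComodule K C P] {g : N →ₗ[K] P} {h : M →ₗ[K] N} (hgh : IsComoduleHom C (g ∘ₗ h))
    (hg : IsComoduleHom C g) (hg_inj : Function.Injective g) : IsComoduleHom C h := by
  refine isComoduleHom_iff_dualMap_smul.2 fun f φ => ?_
  obtain ⟨ψ, rfl⟩ := hg.dualMap_surjective_iff.2 hg_inj φ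
  rw [← map_smul]
  exact isComoduleHom_iff_dualMap_smul.1 hgh f ψ

theorem isSubcomodule_iff_smul_mem_dualAnnihilator {N : Submodule K M} :
    IsSubcomodule K C M N ↔
      ∀ (f : DualAlg K C), ∀ φ ∈ N.dualAnnihilator, f • φ ∈ N.dualAnnihilator := by
  have mem_range_iff (m : M) :
      coact m ∈ LinearMap.range (N.subtype.lTensor C) ↔ ∀ (f : DualAlg K C),
        ∀ φ ∈ N.dualAnnihilator, (f • φ) m = 0 := by
    rw [← lTensor_mkQ, LinearMap.mem_ker]
    constructor
    · intro hm f φ hφ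
      rw [← Submodule.range_dualMap_mkQ_eq] at hφ
      obtain ⟨ψ, rfl⟩ := hφ
      rw [smul_dualMap_apply, hm, map_zero, map_zero]
    · intro hm
      refine tensorProduct_ext_dual fun f ψ => ?_
      rw [← smul_dualMap_apply (WithConv.toConv f), map_zero, map_zero]
      refine hm _ _ ?_
      rw [← Submodule.range_dualMap_mkQ_eq]
      exact LinearMap.mem_range_self _ ψ
  simp only [IsSubcomodule, mem_range_iff, Submodule.mem_dualAnnihilator]
  exact ⟨fun h f φ hφ m hm => h m hm f φ hφ, fun h m hm f φ hφ => h f φ hφ m hm⟩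

end Transpose

section Subcomodule

variable {K C M N : Type*} [Field K] [AddCommGroup C] [Module K C] [Coalgebra K C]
  [AddCommGroup M] [Module K M] [LeftComodule K C M]
  [AddCommGroup N] [Module K N] [LeftComodule K C N]

variable (K C M) in
/-- The subcomodules of `M`, ordered by inclusion; `IsArtinianComodule` is the descending chain
condition on this order. -/
abbrev Subcomodule : Type _ := {N : Submodule K M // IsSubcomodule K C M N}

/-- The kernel of a comodule morphism, as a subcomodule. -/
def IsComoduleHom.ker {h : M →ₗ[K] N} (hh : IsComoduleHom C h) : Subcomodule K C M where
  val := LinearMap.ker h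
  property := by
    rw [isSubcomodule_iff_smul_mem_dualAnnihilator,
      ← LinearMap.range_dualMap_eq_dualAnnihilator_ker]
    rintro f _ ⟨φ, rfl⟩
    exact ⟨f • φ, hh.dualMap.map_smul f φ⟩

namespace Subcomodule

/-- The annihilator `N^⊥ ⊆ M^*` of a subcomodule `N ⊆ M`, as a `C^*`-submodule. -/
def dualAnnihilator (N : Subcomodule K C M) : Submodule (DualAlg K C) (Module.Dual K M) where
  __ := N.1.dualAnnihilator.toAddSubmonoid
  smul_mem' f _ hφ := isSubcomodule_iff_smul_mem_dualAnnihilator.1 N.2 f _ hφ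

theorem dualAnnihilator_le_dualAnnihilator_iff {N P : Subcomodule K C M} :
    N.dualAnnihilator ≤ P.dualAnnihilator ↔ P ≤ N :=
  Subspace.dualAnnihilator_le_dualAnnihilator_iff

theorem dualAnnihilator_lt_dualAnnihilator_iff {N P : Subcomodule K C M} :
    N.dualAnnihilator < P.dualAnnihilator ↔ P < N := by
  simp only [lt_iff_le_not_ge, dualAnnihilator_le_dualAnnihilator_iff]

theorem dualAnnihilator_ker {h : M →ₗ[K] N} (hh : IsComoduleHom C h) :
    hh.ker.dualAnnihilator = LinearMap.range hh.dualMap :=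
  SetLike.ext fun φ => (SetLike.ext_iff.1 (LinearMap.range_dualMap_eq_dualAnnihilator_ker h) φ).symm

/-- The restriction of the coaction of `M` to a subcomodule. -/
noncomputable def restrictCoact (N : Subcomodule K C M) : N.1 →ₗ[K] C ⊗[K] N.1 :=
  LinearMap.codRestrictOfInjective (coact ∘ₗ N.1.subtype) (N.1.subtype.lTensor C)
    (Module.Flat.lTensor_preserves_injective_linearMap _ N.1.subtype_injective) fun m => N.2 m m.2

theorem lTensor_subtype_comp_restrictCoact (N : Subcomodule K C M) :
    N.1.subtype.lTensor C ∘ₗ N.restrictCoact = coact ∘ₗ N.1.subtype :=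
  LinearMap.codRestrictOfInjective_comp _ _ _ _

/-- A subcomodule `N ⊆ M` as a comodule. Since `C ⊗ -` preserves the injection `N → M`, the axioms
can be checked in `M`. -/
noncomputable instance leftComodule (N : Subcomodule K C M) : LeftComodule K C N.1 where
  coact := N.restrictCoact
  coassoc := by
    have lTensor_injective := Module.Flat.lTensor_preserves_injective_linearMap (M := C) _
      (Module.Flat.lTensor_preserves_injective_linearMap (M := C) _ N.1.subtype_injective)
    rw [← LinearMap.cancel_left lTensor_injective]
    have naturality : (N.1.subtype.lTensor C).lTensor C ∘ₗ (TensorProduct.assoc K C C N.1) ∘ₗ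
        (Coalgebra.comul (R := K) (A := C)).rTensor N.1 =
          (TensorProduct.assoc K C C M) ∘ₗ (Coalgebra.comul (R := K) (A := C)).rTensor M ∘ₗ
            N.1.subtype.lTensor C := by
      rw [LinearMap.rTensor_comp_lTensor, ← LinearMap.lTensor_comp_rTensor,
        LinearMap.lTensor_tensor]
      ext; simp
    calc
      _ = ((N.1.subtype.lTensor C).lTensor C ∘ₗ (TensorProduct.assoc K C C N.1) ∘ₗ
          (Coalgebra.comul (R := K) (A := C)).rTensor N.1) ∘ₗ N.restrictCoact := rfl
      _ = ((TensorProduct.assoc K C C M).toLinearMap ∘ₗ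
          (Coalgebra.comul (R := K) (A := C)).rTensor M ∘ₗ coact) ∘ₗ N.1.subtype := by
        rw [naturality]
        simp only [LinearMap.comp_assoc, lTensor_subtype_comp_restrictCoact]
      _ = coact.lTensor C ∘ₗ N.1.subtype.lTensor C ∘ₗ N.restrictCoact := by
        rw [coassoc, LinearMap.comp_assoc, lTensor_subtype_comp_restrictCoact]
      _ = (N.1.subtype.lTensor C ∘ₗ N.restrictCoact).lTensor C ∘ₗ N.restrictCoact := by
        rw [← LinearMap.comp_assoc, ← LinearMap.lTensor_comp, lTensor_subtype_comp_restrictCoact]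
      _ = _ := by
        rw [LinearMap.lTensor_comp, LinearMap.comp_assoc]
  counit_coact := by
    have lTensor_injective :=
      Module.Flat.lTensor_preserves_injective_linearMap (M := K) _ N.1.subtype_injective
    rw [← LinearMap.cancel_left lTensor_injective, ← LinearMap.comp_assoc,
      LinearMap.lTensor_comp_rTensor, ← LinearMap.rTensor_comp_lTensor, LinearMap.comp_assoc,
      lTensor_subtype_comp_restrictCoact, ← LinearMap.comp_assoc, counit_coact]
    rfl

theorem isComoduleHom_subtype (N : Subcomodule K C M) : IsComoduleHom C N.1.subtype :=
  N.lTensor_subtype_comp_restrictCoact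

/-- The dual of a subcomodule `N ⊆ M` is `M^* / N^⊥`, through restriction of linear forms. -/
noncomputable def quotDualAnnihilatorEquiv (N : Subcomodule K C M) :
    (Module.Dual K M ⧸ N.dualAnnihilator) ≃ₗ[DualAlg K C] Module.Dual K N.1 :=
  Submodule.quotEquivOfEq _ _
      (SetLike.ext fun φ =>
        (SetLike.ext_iff.1 N.1.dualRestrict_ker_eq_dualAnnihilator φ).symm) ≪≫ₗ
    N.isComoduleHom_subtype.dualMap.quotKerEquivOfSurjective
      (N.isComoduleHom_subtype.dualMap_surjective_iff.2 N.1.subtype_injective)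

end Subcomodule

end Subcomodule

section Cofree

variable {K C M : Type*} [Field K] [AddCommGroup C] [Module K C] [Coalgebra K C]
  [AddCommGroup M] [Module K M] [LeftComodule K C M]
  {ι : Type} [Fintype ι] [DecidableEq ι]

variable (K C) in
/-- The dual of the comodule `C` is the left regular module `C^*`. -/
def dualSelfEquiv : Module.Dual K C ≃ₗ[DualAlg K C] DualAlg K C where
  __ := (WithConv.addEquiv (Module.Dual K C)).symm
  map_smul' _ _ := rfl

theorem isComoduleHom_single (i : ι) :
    IsComoduleHom C (LinearMap.single K (fun _ : ι => M) i) := by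
  refine LinearMap.ext fun m => ?_
  simp only [coact, LinearMap.comp_apply, LinearMap.sum_apply, LinearMap.proj_apply]
  rw [Finset.sum_eq_single i]
  · simp
  · intro j _ hj
    simp [Pi.single_eq_of_ne hj]
  · simp

variable (K C ι) in
/-- The dual of the cofree comodule `C^ι` is the free module `(C^*)^ι`. -/
noncomputable def dualPiEquiv : Module.Dual K (ι → C) ≃ₗ[DualAlg K C] (ι → DualAlg K C) where
  __ := LinearMap.pi fun i =>
    (dualSelfEquiv K C).toLinearMap ∘ₗ (isComoduleHom_single (M := C) i).dualMap
  invFun f := LinearMap.lsum K (fun _ : ι => C) K fun i => (f i).ofConv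
  left_inv := (LinearMap.lsum K (fun _ : ι => C) K).right_inv
  right_inv f := funext fun i => WithConv.ofConv_injective <|
    congrFun ((LinearMap.lsum K (fun _ : ι => C) K).left_inv fun j => (f j).ofConv) i

variable (K C ι) in
/-- The basis of `(C^ι)^*` over `C^*` given by the forms `x ↦ ε(x i)`, the coordinates of
`F` being its restrictions to the summands of `C^ι`. -/
noncomputable def dualPiBasis : Module.Basis ι (DualAlg K C) (Module.Dual K (ι → C)) :=
  .ofEquivFun (dualPiEquiv K C ι)

/-- The linear map `M → C^ι`, `m ↦ (∑ φᵢ(m₀) m₋₁)ᵢ`, attached to a family of linear forms on `M`.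
These are exactly the comodule morphisms `M → C^ι`, since `C^ι` is cofree. -/
noncomputable def coeffMap {ι : Type*} (φ : ι → Module.Dual K M) : M →ₗ[K] (ι → C) :=
  LinearMap.pi fun i => (TensorProduct.rid K C).toLinearMap ∘ₗ (φ i).lTensor C ∘ₗ coact

theorem apply_coeffMap {ι : Type*} (f : DualAlg K C) (φ : ι → Module.Dual K M) (m : M) (i : ι) :
    f.ofConv (coeffMap φ m i) = (f • φ i) m := by
  rw [dual_smul_apply, coeffMap, LinearMap.pi_apply, LinearMap.comp_apply, LinearMap.comp_apply]
  induction coact (K := K) (C := C) m with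
  | zero => simp
  | add x y hx hy => simp only [map_add, hx, hy]
  | tmul c x => simp [mul_comm]

theorem coeffMap_dualMap_apply (φ : ι → Module.Dual K M) (F : Module.Dual K (ι → C)) :
    (coeffMap φ).dualMap F = (dualPiBasis K C ι).constr ℕ φ F := by
  ext m
  rw [Module.Basis.constr_apply_fintype, LinearMap.sum_apply, LinearMap.dualMap_apply,
    ← Finset.univ_sum_single (coeffMap φ m), map_sum]
  exact Finset.sum_congr rfl fun i _ => apply_coeffMap (dualPiEquiv K C ι F i) φ m i

theorem isComoduleHom_coeffMap (φ : ι → Module.Dual K M) :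
    IsComoduleHom C (coeffMap (C := C) φ) :=
  isComoduleHom_iff_dualMap_smul.2 fun f F => by simp only [coeffMap_dualMap_apply, map_smul]

theorem dualMap_isComoduleHom_coeffMap (φ : ι → Module.Dual K M) :
    (isComoduleHom_coeffMap (C := C) φ).dualMap = (dualPiBasis K C ι).constr ℕ φ :=
  LinearMap.ext (coeffMap_dualMap_apply φ)

theorem range_dualMap_coeffMap (φ : ι → Module.Dual K M) :
    LinearMap.range (isComoduleHom_coeffMap (C := C) φ).dualMap =
      Submodule.span (DualAlg K C) (Set.range φ) := by
  rw [dualMap_isComoduleHom_coeffMap, Module.Basis.constr_range]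

theorem exists_dualMap_eq_of_pi (α : Module.Dual K (ι → C) →ₗ[DualAlg K C] Module.Dual K M) :
    ∃ (h : M →ₗ[K] (ι → C)) (hh : IsComoduleHom C h), hh.dualMap = α :=
  ⟨_, isComoduleHom_coeffMap fun i => α (dualPiBasis K C ι i), by
    rw [dualMap_isComoduleHom_coeffMap, Module.Basis.constr_self]⟩

theorem Subcomodule.exists_dualAnnihilator_eq_of_fg
    {W : Submodule (DualAlg K C) (Module.Dual K M)} (hW : W.FG) :
    ∃ N : Subcomodule K C M, N.dualAnnihilator = W := by
  obtain ⟨n, φ, rfl⟩ := Submodule.fg_iff_exists_fin_generating_family.1 hW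
  exact ⟨(isComoduleHom_coeffMap φ).ker, by rw [dualAnnihilator_ker, range_dualMap_coeffMap]⟩

end Cofree

section Finiteness

variable {K C M N : Type*} [Field K] [AddCommGroup C] [Module K C] [Coalgebra K C]
  [AddCommGroup M] [Module K M] [LeftComodule K C M]
  [AddCommGroup N] [Module K N] [LeftComodule K C N]

theorem isArtinianComodule_iff_isNoetherian_dual :
    IsArtinianComodule K C M ↔ IsNoetherian (DualAlg K C) (Module.Dual K M) := by
  constructor
  · intro (_ : WellFoundedLT (Subcomodule K C M))
    choose perp dualAnnihilator_perp using
      fun W : {W : Submodule (DualAlg K C) (Module.Dual K M) // W.FG} =>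
        Subcomodule.exists_dualAnnihilator_eq_of_fg W.2
    have perp_strictAnti : StrictAnti perp := fun V W hVW => by
      rwa [← Subcomodule.dualAnnihilator_lt_dualAnnihilator_iff, dualAnnihilator_perp,
        dualAnnihilator_perp]
    exact isNoetherian_iff_fg_wellFounded.2 perp_strictAnti.wellFoundedGT
  · intro _
    have dualAnnihilator_strictAnti :
        StrictAnti (Subcomodule.dualAnnihilator (K := K) (C := C) (M := M)) := fun _ _ =>
      Subcomodule.dualAnnihilator_lt_dualAnnihilator_iff.2
    exact dualAnnihilator_strictAnti.wellFoundedLT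

theorem isFinitelyCogenerated_iff_finite_dual :
    IsFinitelyCogenerated K C M ↔ Module.Finite (DualAlg K C) (Module.Dual K M) := by
  constructor
  · rintro ⟨n, -, f, hf, f_injective⟩
    have := Module.Finite.of_basis (dualPiBasis K C (Fin n))
    exact Module.Finite.of_surjective _ (hf.dualMap_surjective_iff.2 f_injective)
  · intro _
    obtain ⟨n, φ, span_φ⟩ := Module.Finite.exists_fin (R := DualAlg K C) (M := Module.Dual K M)
    -- The extra form `0` makes the exponent positive when `M = 0`.
    let ψ : Fin (n + 1) → Module.Dual K M := Fin.cons 0 φ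
    have span_ψ : Submodule.span (DualAlg K C) (Set.range ψ) = ⊤ := by
      rw [Fin.range_cons, Submodule.span_insert_zero, span_φ]
    exact ⟨n + 1, n.succ_pos, coeffMap ψ, isComoduleHom_coeffMap ψ,
      (isComoduleHom_coeffMap ψ).dualMap_surjective_iff.1 <| LinearMap.range_eq_top.1 <|
        (range_dualMap_coeffMap ψ).trans span_ψ⟩

theorem exists_dualMap_eq (hN : IsFinitelyCogenerated K C N)
    (α : Module.Dual K N →ₗ[DualAlg K C] Module.Dual K M) :
    ∃ (h : M →ₗ[K] N) (hh : IsComoduleHom C h), hh.dualMap = α := by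
  obtain ⟨n, -, g, hg, g_injective⟩ := hN
  obtain ⟨k, hk, dualMap_k⟩ := exists_dualMap_eq_of_pi (α ∘ₗ hg.dualMap)
  have k_dualMap_apply (F : Module.Dual K (Fin n → C)) : k.dualMap F = α (g.dualMap F) :=
    LinearMap.congr_fun dualMap_k F
  have range_le : LinearMap.range k ≤ LinearMap.range g := by
    rw [← Subspace.dualAnnihilator_le_dualAnnihilator_iff,
      ← LinearMap.ker_dualMap_eq_dualAnnihilator_range,
      ← LinearMap.ker_dualMap_eq_dualAnnihilator_range]
    intro F hF
    rw [LinearMap.mem_ker, k_dualMap_apply, LinearMap.mem_ker.1 hF, map_zero]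
  let h := k.codRestrictOfInjective g g_injective fun m => range_le ⟨m, rfl⟩
  have g_comp_h : g ∘ₗ h = k := k.codRestrictOfInjective_comp _ _ _
  have hh : IsComoduleHom C h := .of_comp_of_injective (g_comp_h ▸ hk) hg g_injective
  refine ⟨h, hh, LinearMap.ext fun φ => ?_⟩
  obtain ⟨F, rfl⟩ := hg.dualMap_surjective_iff.2 g_injective φ
  refine Eq.trans ?_ (k_dualMap_apply F)
  rw [← g_comp_h]
  rfl

theorem exists_subcomodule_pi_dual_equiv (X : Type*) [AddCommGroup X] [Module (DualAlg K C) X]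
    [Module.FinitePresentation (DualAlg K C) X] :
    ∃ (n : ℕ) (N : Subcomodule K C (Fin n → C)),
      Nonempty (Module.Dual K N.1 ≃ₗ[DualAlg K C] X) := by
  obtain ⟨n, W, e, hW⟩ := Module.FinitePresentation.exists_fin (DualAlg K C) X
  obtain ⟨N, dualAnnihilator_N⟩ := Subcomodule.exists_dualAnnihilator_eq_of_fg
    (hW.map (dualPiEquiv K C (Fin n)).symm.toLinearMap)
  exact ⟨n, N, ⟨N.quotDualAnnihilatorEquiv.symm ≪≫ₗ
    (Submodule.Quotient.equiv W N.dualAnnihilator (dualPiEquiv K C (Fin n)).symm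
      dualAnnihilator_N.symm).symm ≪≫ₗ e.symm⟩⟩

end Finiteness

end LeftComodule

theorem isNoetherian_iff_finite_of_isNoetherianRing (R M : Type*) [Ring R] [IsNoetherianRing R]
    [AddCommGroup M] [Module R M] : IsNoetherian R M ↔ Module.Finite R M :=
  ⟨fun _ => inferInstance, fun _ => inferInstance⟩

theorem isLeftArtinianCoalgebra_iff_isNoetherianRing (K C : Type*) [Field K] [AddCommGroup C]
    [Module K C] [Coalgebra K C] :
    IsLeftArtinianCoalgebra K C ↔ IsNoetherianRing (DualAlg K C) := by
  rw [IsLeftArtinianCoalgebra, LeftComodule.isArtinianComodule_iff_isNoetherian_dual,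
    isNoetherianRing_iff, (LeftComodule.dualSelfEquiv K C).isNoetherian_iff]

namespace LeftComod

variable (K : Type u) (C : Type v) [Field K] [AddCommGroup C] [Module K C] [Coalgebra K C]

instance faithful_dualFunctor : (dualFunctor K C).Faithful where
  map_injective {X Y} g h hgh := by
    have dualMap_eq : g.unop.toLin.dualMap = h.unop.toLin.dualMap :=
      LinearMap.ext fun φ => LinearMap.congr_fun (congrArg ModuleCat.Hom.hom hgh) φ
    refine Quiver.Hom.unop_inj (Hom.ext (LinearMap.ext fun m => ?_))
    exact Module.eval_apply_injective K <| LinearMap.ext fun φ =>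
      LinearMap.congr_fun (LinearMap.congr_fun dualMap_eq φ) m

instance full_finitelyCogenerated_dualFunctor :
    ((finitelyCogenerated K C).ι.op ⋙ dualFunctor K C).Full where
  map_surjective {X Y} α := by
    obtain ⟨h, hh, dualMap_h⟩ := LeftComodule.exists_dualMap_eq X.unop.property α.hom
    let k : Y.unop.obj ⟶ X.unop.obj := ⟨h, hh⟩
    exact ⟨(ObjectProperty.homMk k).op, ModuleCat.hom_ext dualMap_h⟩

theorem exists_finitelyCogenerated_iso (X : ModuleCat.{max u v} (DualAlg K C))
    [Module.FinitePresentation (DualAlg K C) X] :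
    ∃ Y : LeftComod K C, finitelyCogenerated K C Y ∧
      Nonempty ((dualFunctor K C).obj (Opposite.op Y) ≅ X) := by
  obtain ⟨n, N, ⟨e⟩⟩ := LeftComodule.exists_subcomodule_pi_dual_equiv (K := K) (C := C) X
  exact ⟨⟨N.1⟩, LeftComodule.isFinitelyCogenerated_iff_finite_dual.2 (.equiv e.symm),
    ⟨e.toModuleIso⟩⟩

variable [IsNoetherianRing (DualAlg K C)]

theorem noetherian_eq_finitelyGenerated : noetherian K C = finitelyGenerated K C :=
  funext fun X => propext (isNoetherian_iff_finite_of_isNoetherianRing _ X)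

theorem artinian_eq_finitelyCogenerated : artinian K C = finitelyCogenerated K C :=
  funext fun X => propext <| by
    rw [artinian, finitelyCogenerated, LeftComodule.isArtinianComodule_iff_isNoetherian_dual,
      LeftComodule.isFinitelyCogenerated_iff_finite_dual,
      isNoetherian_iff_finite_of_isNoetherianRing]

theorem isDuality_finitelyCogenerated_finitelyGenerated :
    IsDuality K C (finitelyCogenerated K C) (finitelyGenerated K C) := by
  refine ⟨fun X => LeftComodule.isFinitelyCogenerated_iff_finite_dual.1 X.unop.property,
    { faithful := .of_comp_iso (ObjectProperty.liftCompιIso _ _ _)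
      full := .of_comp_faithful_iso (ObjectProperty.liftCompιIso _ _ _)
      essSurj := ⟨fun X => ?_⟩ }⟩
  have : Module.Finite (DualAlg K C) X.obj := X.property
  have := Module.finitePresentation_of_finite (DualAlg K C) X.obj
  obtain ⟨Y, hY, ⟨e⟩⟩ := exists_finitelyCogenerated_iso K C X.obj
  exact ⟨Opposite.op ⟨Y, hY⟩, ⟨(ObjectProperty.fullyFaithfulι _).preimageIso e⟩⟩

end LeftComod

theorem mainTheorem7 (K : Type u) (C : Type v) [Field K] [AddCommGroup C] [Module K C]
    [Coalgebra K C] :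
    (IsLeftArtinianCoalgebra K C ↔ IsNoetherianRing (DualAlg K C)) ∧
    (IsLeftArtinianCoalgebra K C →
      LeftComod.artinian K C = LeftComod.finitelyCogenerated K C ∧
      LeftComod.noetherian K C = LeftComod.finitelyGenerated K C ∧
      LeftComod.IsDuality K C (LeftComod.artinian K C) (LeftComod.noetherian K C) ∧
      LeftComod.IsDuality K C (LeftComod.finitelyCogenerated K C)
        (LeftComod.finitelyGenerated K C)) := by
  have artinian_iff_noetherian := isLeftArtinianCoalgebra_iff_isNoetherianRing K C
  refine ⟨artinian_iff_noetherian, fun hC => ?_⟩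
  have := artinian_iff_noetherian.1 hC
  have comodules_eq := LeftComod.artinian_eq_finitelyCogenerated K C
  have modules_eq := LeftComod.noetherian_eq_finitelyGenerated K C
  have duality := LeftComod.isDuality_finitelyCogenerated_finitelyGenerated K C
  exact ⟨comodules_eq, modules_eq, by rwa [comodules_eq, modules_eq], duality⟩
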